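/- Let $n\ge 0$, let $\mathfrak g=sl(n+1,\mathbb C)$ be the Lie algebra of traceless complex $(n+1)\times(n+1)$ matrices, let $\mathfrak h\subset\mathfrak g$ be a Cartan subalgebra, let $\Delta^+$ be a positive system in the root system of $(\mathfrak g,\mathfrak h)$, and let $\mathfrak b=\mathfrak h\oplus\bigoplus_{\alpha\in\Delta^+}\mathfrak g_\alpha$ be the corresponding Borel subalgebra. Let $\mathcal I^n$ be the set of $ad$-nilpotent ideals of $\mathfrak b$, i.e. of the ideals $\mathfrak i$ of $\mathfrak b$ such that $\operatorname{ad}x$ is a nilpotent endomorphism of $\mathfrak g$ for every $x\in\mathfrak i$. For $\mathfrak i\in\mathcal I^n$ put $\mathfrak i^1=\mathfrak i$ and $\mathfrak i^{m+1}=[\mathfrak i,\mathfrak i^m]$ for $m\geq 1$; the class of nilpotence of $\mathfrak i$ is the least $m\ge 0$ with $\mathfrak i^{m+1}=0$ (so it is $0$ exactly for the zero ideal, and at most $1$ exactly for the Abelian ideals). Let $F_0=F_1=1$ and $F_{k+2}=F_{k+1}+F_k$ for $k\ge0$. Then the number of ideals in $\mathcal I^n$ with class of nilpotence at most $2$ is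 the Fibonacci number $F_{2n}$, and the number of ideals in $\mathcal I^n$ with class of nilpotence at most $3$ is $(3^n+1)/2$. -/

import Mathlib

noncomputable section

namespace AdNilpotentIdeals

open LieAlgebra

variable {L : Type*} [LieRing L] [LieAlgebra ℂ L]

/-- The roots of a complex Lie algebra `L` relative to a Cartan subalgebra `H`: the nonzero
functions on `H` with a nonzero root space.  (Mathlib's `rootSpace` is the generalized simultaneous
eigenspace of `ad H`; for semisimple `L` this is the ordinary one.) -/
def roots (H : LieSubalgebra ℂ L) [H.IsCartanSubalgebra] : Set (H → ℂ) :=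
  {α | α ≠ 0 ∧ rootSpace H α ≠ ⊥}

/-- A positive system in the root system of `(L, H)`: a set of roots, closed under those sums that
are roots, that contains exactly one of `α` and `-α` for each root `α`. -/
structure IsPositiveSystem (H : LieSubalgebra ℂ L) [H.IsCartanSubalgebra]
    (P : Set (H → ℂ)) : Prop where
  subset_roots : P ⊆ roots H
  mem_or_neg_mem : ∀ α ∈ roots H, α ∈ P ∨ -α ∈ P
  neg_notMem : ∀ α ∈ P, -α ∉ P
  add_mem : ∀ α ∈ P, ∀ β ∈ P, α + β ∈ roots H → α + β ∈ P

/-- The sum `𝔫` of the root spaces of the roots in `P`. -/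
def nilradicalSubmodule (H : LieSubalgebra ℂ L) [H.IsCartanSubalgebra]
    (P : Set (H → ℂ)) : Submodule ℂ L :=
  ⨆ α ∈ P, (rootSpace H α).toSubmodule

theorem lie_mem_nilradicalSubmodule_of_cartan {H : LieSubalgebra ℂ L} [H.IsCartanSubalgebra]
    {P : Set (H → ℂ)} {h y : L} (hh : h ∈ H)
    (hy : y ∈ nilradicalSubmodule H P) : ⁅h, y⁆ ∈ nilradicalSubmodule H P := by
  have key : nilradicalSubmodule H P ≤
      (nilradicalSubmodule H P).comap (ad ℂ L h) := by
    refine iSup₂_le fun α hα y hy => ?_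
    refine (le_iSup₂ (f := fun (α : H → ℂ) (_ : α ∈ P) => (rootSpace H α).toSubmodule) α hα) ?_
    exact (rootSpace H α).lie_mem (x := (⟨h, hh⟩ : H)) hy
  exact key hy

theorem lie_mem_nilradicalSubmodule {H : LieSubalgebra ℂ L} [H.IsCartanSubalgebra]
    {P : Set (H → ℂ)} (hP : IsPositiveSystem H P) {x y : L}
    (hx : x ∈ nilradicalSubmodule H P) (hy : y ∈ nilradicalSubmodule H P) :
    ⁅x, y⁆ ∈ nilradicalSubmodule H P := by
  have key : ∀ α ∈ P, ∀ x ∈ rootSpace H α, nilradicalSubmodule H P ≤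
      (nilradicalSubmodule H P).comap (ad ℂ L x) := by
    intro α hα x hx
    refine iSup₂_le fun β hβ y hy => ?_
    have hxy : ⁅x, y⁆ ∈ rootSpace H (α + β) :=
      lie_mem_genWeightSpace_of_mem_genWeightSpace hx hy
    change ⁅x, y⁆ ∈ nilradicalSubmodule H P
    by_cases hb : rootSpace H (α + β) = ⊥
    · rw [hb, LieSubmodule.mem_bot] at hxy
      rw [hxy]
      exact zero_mem _
    · have h0 : α + β ≠ 0 := by
        intro h0
        rw [← neg_eq_of_add_eq_zero_right h0] at hβ
        exact hP.neg_notMem α hα hβ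
      exact (le_iSup₂ (f := fun (α : H → ℂ) (_ : α ∈ P) => (rootSpace H α).toSubmodule)
        (α + β) (hP.add_mem α hα β hβ ⟨h0, hb⟩)) hxy
  have key' : nilradicalSubmodule H P ≤
      (nilradicalSubmodule H P).comap (ad ℂ L y) := by
    refine iSup₂_le fun α hα x hx => ?_
    have := key α hα x hx hy
    change ⁅y, x⁆ ∈ nilradicalSubmodule H P
    rw [← lie_skew]
    exact neg_mem this
  have := key' hx
  rw [← lie_skew]
  exact neg_mem this

/-- The Borel subalgebra `𝔟 = 𝔥 ⊕ 𝔫` attached to a Cartan subalgebra and a positive system. -/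
def borel (H : LieSubalgebra ℂ L) [H.IsCartanSubalgebra] (P : Set (H → ℂ))
    (hP : IsPositiveSystem H P) : LieSubalgebra ℂ L where
  toSubmodule := H.toSubmodule ⊔ nilradicalSubmodule H P
  lie_mem' := by
    intro x y hx hy
    obtain ⟨a, ha, b, hb, rfl⟩ := Submodule.mem_sup.1 hx
    obtain ⟨c, hc, d, hd, rfl⟩ := Submodule.mem_sup.1 hy
    have h1 : ⁅a, c⁆ ∈ H := H.lie_mem ha hc
    have h2 : ⁅a, d⁆ ∈ nilradicalSubmodule H P := lie_mem_nilradicalSubmodule_of_cartan ha hd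
    have h3 : ⁅b, c⁆ ∈ nilradicalSubmodule H P := by
      rw [← lie_skew]
      exact neg_mem (lie_mem_nilradicalSubmodule_of_cartan hc hb)
    have h4 : ⁅b, d⁆ ∈ nilradicalSubmodule H P := lie_mem_nilradicalSubmodule hP hb hd
    refine Submodule.mem_sup.2 ⟨⁅a, c⁆, h1, ⁅a, d⁆ + (⁅b, c⁆ + ⁅b, d⁆),
      add_mem h2 (add_mem h3 h4), ?_⟩
    simp only [add_lie, lie_add]
    abel

/-- An ideal of a Lie subalgebra `B` of `L` is `ad`-nilpotent if it consists of elements `x` for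
which `ad x` is a nilpotent endomorphism of `L`. -/
def IsAdNilpotent {B : LieSubalgebra ℂ L} (I : LieIdeal ℂ B) : Prop :=
  ∀ x ∈ I, IsNilpotent (ad ℂ L (x : L))

/-- The class of nilpotence of an ideal `I`, considered as a Lie algebra: the least `m` with
`I ^ (m + 1) = 0`, where `I ^ 1 = I` and `I ^ (m + 1) = ⁅I, I ^ m⁆`.  Thus it is `0` exactly for
the zero ideal, and at most `1` exactly for the Abelian ones. -/
def nilpotenceClass {B : LieSubalgebra ℂ L} (I : LieIdeal ℂ B) : ℕ :=
  LieModule.nilpotencyLength I I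

end AdNilpotentIdeals

end

/-! Put N = n + 1 and number rows and columns from 0. In a suitable basis the Cartan subalgebra is
the diagonal one and the Borel subalgebra is upper triangular. An ad-nilpotent ideal then consists
of strictly upper triangular matrices. Stability under the diagonal makes it a span of elementary
matrices, and stability under the Borel makes the set of positions closed upwards and to the right.
Such a set is {(i, j) : f i ≤ j} for a unique monotone f with j < f j for j < N and f ≤ N
(`exists_eq_supportIdeal`, `supportIdeal_injective`).

Since E i m and E m j bracket to E i j, the power I^(m+1) is supported where f^[m+1] i ≤ j. Hence I
has class at most m exactly when f^[m+1] 0 = N (`nilpotenceClass_supportIdeal_le_iff`): the bounce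
path of f reaches N within m + 1 steps.

The functions with f^[k] 0 = N are counted by the coefficient of X^N in the continued fraction D
(k+1), where D 0 = 0 and D (k+1) = 1 / (1 - X * D k) (`ncard_bounceFunctions`). These are the series
of Dyck paths of bounded height. For k = 3 and k = 4 they are (1 - 2X)/(1 - 3X + X²) and (1 - 3X +
X²)/((1 - X)(1 - 3X)), whose coefficients are the claimed numbers.

A Cartan subalgebra H is diagonalized through the generalized weight spaces of the standard
representation: H contains every traceless block diagonal matrix, so its nilpotency forces blocks of
size one (`weight_injective`). -/

namespace AdNilpotentIdeals

/-! ### Counting bounce functions by continued fractions -/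

/-- The nondecreasing functions bounded by `N` that lie strictly above the diagonal on `[0, N)`. -/
def bounceFunctions (N : ℕ) : Set (ℕ → ℕ) :=
  {f | Monotone f ∧ (∀ j, j < N → j < f j) ∧ ∀ j, f j ≤ N}

/-- The functions in `bounceFunctions N` that agree with `g` on `[0, i)`, are at least `v` on
`[i, ∞)` and reach `N` from `e` after `k` iterations. -/
def bounceExtensions (N k i e v : ℕ) (g : ℕ → ℕ) : Set (ℕ → ℕ) :=
  {f | f ∈ bounceFunctions N ∧ (∀ j, j < i → f j = g j) ∧ (∀ j, i ≤ j → v ≤ f j) ∧ f^[k] e = N}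

/-- The convergents of the continued fraction `1 / (1 - X / (1 - X / ⋯))`. -/
noncomputable def dyckSeries : ℕ → PowerSeries ℚ
  | 0 => 0
  | k + 1 => (1 - PowerSeries.X * dyckSeries k)⁻¹

lemma dyckSeries_succ_mul (k : ℕ) :
    dyckSeries (k + 1) * (1 - PowerSeries.X * dyckSeries k) = 1 := by
  rw [dyckSeries]
  exact PowerSeries.inv_mul_cancel _ (by simp)

lemma dyckSeries_one : dyckSeries 1 = 1 := by
  simp [dyckSeries]

lemma coeff_dyckSeries_zero (k r q : ℕ) :
    PowerSeries.coeff 0 (dyckSeries (k + 1) ^ (r + 1) * dyckSeries k ^ q) =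
      PowerSeries.coeff 0 (dyckSeries (k + 1) ^ r * dyckSeries k ^ q) := by
  have h : dyckSeries (k + 1) = 1 + PowerSeries.X * (dyckSeries (k + 1) * dyckSeries k) := by
    linear_combination dyckSeries_succ_mul k
  have : dyckSeries (k + 1) ^ (r + 1) * dyckSeries k ^ q =
      dyckSeries (k + 1) ^ r * dyckSeries k ^ q +
        PowerSeries.X * (dyckSeries (k + 1) ^ (r + 1) * dyckSeries k ^ (q + 1)) := by
    rw [pow_succ]
    nth_rw 2 [h]
    ring
  rw [this]
  simp

/-- Expand one factor by D (k+1) = 1 + X * D (k+1) * D k. The two terms match the two cases f i = v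
and f i > v in the count. -/
lemma coeff_dyckSeries_succ (k r q m : ℕ) :
    PowerSeries.coeff (m + 1) (dyckSeries (k + 1) ^ (r + 1) * dyckSeries k ^ q) =
      PowerSeries.coeff (m + 1) (dyckSeries (k + 1) ^ r * dyckSeries k ^ q) +
      PowerSeries.coeff m (dyckSeries (k + 1) ^ (r + 1) * dyckSeries k ^ (q + 1)) := by
  have h : dyckSeries (k + 1) = 1 + PowerSeries.X * (dyckSeries (k + 1) * dyckSeries k) := by
    linear_combination dyckSeries_succ_mul k
  have : dyckSeries (k + 1) ^ (r + 1) * dyckSeries k ^ q =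
      dyckSeries (k + 1) ^ r * dyckSeries k ^ q +
        PowerSeries.X * (dyckSeries (k + 1) ^ (r + 1) * dyckSeries k ^ (q + 1)) := by
    rw [pow_succ]
    nth_rw 2 [h]
    ring
  conv_lhs => rw [this]
  rw [map_add, PowerSeries.coeff_succ_X_mul]

/-- `g` on `[0, i)`, followed by the value `v` at `i` and the value `N` afterwards. -/
def extendBy (N i v : ℕ) (g : ℕ → ℕ) : ℕ → ℕ :=
  fun j => if j < i then g j else if j = i then v else N

lemma extendBy_mem {N i v : ℕ} {g : ℕ → ℕ} (hg : g ∈ bounceFunctions N)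
    (hv : ∀ j, j < i → g j ≤ v) (hvN : v ≤ N) (hi : i < N → i < v) :
    extendBy N i v g ∈ bounceFunctions N := by
  obtain ⟨h1, h2, h3⟩ := hg
  refine ⟨fun a b hab => ?_, fun j hj => ?_, fun j => ?_⟩
  · have := h1 hab
    have := hv a
    have := h3 a
    have := h3 b
    simp only [extendBy]
    split_ifs <;> omega
  · have := h2 j hj
    simp only [extendBy]
    split_ifs <;> omega
  · have := h3 j
    simp only [extendBy]
    split_ifs <;> omega

lemma bounceExtensions_top {N k i e : ℕ} {g : ℕ → ℕ} (hg : g ∈ bounceFunctions N)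
    (h : ∀ f ∈ bounceFunctions N, (∀ j, i ≤ j → f j = N) → f^[k] e = N) :
    bounceExtensions N k i e N g = {extendBy N i N g} := by
  have hmem := extendBy_mem (i := i) hg (fun j _ => hg.2.2 j) le_rfl id
  have htop : ∀ j, i ≤ j → extendBy N i N g j = N := by
    intro j hj
    simp only [extendBy]
    split_ifs <;> omega
  ext f
  simp only [bounceExtensions, Set.mem_ofPred_eq, Set.mem_singleton_iff]
  constructor
  · rintro ⟨hf, h1, h2, h3⟩
    ext j
    by_cases hj : j < i
    · simp [extendBy, hj, h1 j hj]
    · rw [htop j (by omega)]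
      exact le_antisymm (hf.2.2 j) (h2 j (by omega))
  · rintro rfl
    refine ⟨hmem, fun j hj => by simp [extendBy, hj], fun j hj => (htop j hj).ge, h _ hmem htop⟩

/-- By monotonicity f i > v already raises the lower bound to v + 1 on all of [i, ∞). -/
lemma bounceExtensions_split (N k i e v : ℕ) (g : ℕ → ℕ) :
    bounceExtensions N k i e v g =
      {f | f ∈ bounceExtensions N k i e v g ∧ f i = v} ∪ bounceExtensions N k i e (v + 1) g := by
  ext f
  simp only [bounceExtensions, Set.mem_ofPred_eq, Set.mem_union]
  constructor
  · rintro ⟨hf, h1, h2, h3⟩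
    by_cases hi : f i = v
    · exact Or.inl ⟨⟨hf, h1, h2, h3⟩, hi⟩
    · refine Or.inr ⟨hf, h1, fun j hj => ?_, h3⟩
      have := hf.1 hj
      have := h2 i le_rfl
      omega
  · rintro (h | ⟨hf, h1, h2, h3⟩)
    · exact h.1
    · exact ⟨hf, h1, fun j hj => (Nat.le_succ v).trans (h2 j hj), h3⟩

lemma bounceExtensions_disjoint (N k i e v : ℕ) (g : ℕ → ℕ) :
    Disjoint {f | f ∈ bounceExtensions N k i e v g ∧ f i = v}
      (bounceExtensions N k i e (v + 1) g) := by
  rw [Set.disjoint_left]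
  rintro f ⟨-, h⟩ ⟨-, -, h2, -⟩
  have := h2 i le_rfl
  omega

/-- The pair (k, e) may change to (k', e') because fixing f i when i = e performs one iteration of
the bounce. -/
lemma bounceExtensions_fix {N k k' i e e' v : ℕ} {g : ℕ → ℕ}
    (h : ∀ f : ℕ → ℕ, f i = v → (f^[k] e = N ↔ f^[k'] e' = N)) :
    {f | f ∈ bounceExtensions N k i e v g ∧ f i = v} =
      bounceExtensions N k' (i + 1) e' v (extendBy N i v g) := by
  ext f
  simp only [bounceExtensions, Set.mem_ofPred_eq]
  constructor
  · rintro ⟨⟨hf, h1, h2, h3⟩, hi⟩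
    refine ⟨hf, fun j hj => ?_, fun j hj => h2 j (by omega), (h f hi).1 h3⟩
    simp only [extendBy]
    split_ifs with h' h''
    · exact h1 j h'
    · rw [h'', hi]
    · omega
  · rintro ⟨hf, h1, h2, h3⟩
    have hi : f i = v := by simpa [extendBy] using h1 i (by omega)
    refine ⟨⟨hf, fun j hj => ?_, fun j hj => ?_, (h f hi).2 h3⟩, hi⟩
    · simpa [extendBy, hj] using h1 j (by omega)
    · rcases hj.eq_or_lt with rfl | hj
      · exact hi.ge
      · exact h2 j hj

lemma bounceExtensions_add_one_eq_empty (N k i e : ℕ) (g : ℕ → ℕ) :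
    bounceExtensions N k i e (N + 1) g = ∅ := by
  ext f
  simp only [bounceExtensions, Set.mem_ofPred_eq, Set.mem_empty_iff_false, iff_false]
  rintro ⟨hf, -, h, -⟩
  have := h i le_rfl
  have := hf.2.2 i
  omega

/-- A set is finite with a prescribed number of elements. -/
def HasCard (s : Set (ℕ → ℕ)) (c : ℚ) : Prop := s.Finite ∧ (s.ncard : ℚ) = c

lemma HasCard.union {s t : Set (ℕ → ℕ)} {c d : ℚ} (hs : HasCard s c) (ht : HasCard t d)
    (h : Disjoint s t) : HasCard (s ∪ t) (c + d) := by
  refine ⟨hs.1.union ht.1, ?_⟩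
  rw [Set.ncard_union_eq h hs.1 ht.1, Nat.cast_add, hs.2, ht.2]

lemma hasCard_empty : HasCard ∅ 0 := ⟨Set.finite_empty, by simp⟩

lemma hasCard_singleton (f : ℕ → ℕ) : HasCard {f} 1 := ⟨Set.finite_singleton f, by simp⟩

/-- The induction on r, common to m = 0 and m > 0: `d` is the contribution of the functions whose
lower bound is raised to v + 1, and `hd` is the matching recursion for the coefficients. -/
lemma hasCard_bounceExtensions_step {k m N : ℕ}
    (ihk : ∀ (r i q : ℕ) (g : ℕ → ℕ), N = i + r + q + m → g ∈ bounceFunctions N →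
      (∀ j, j < i → g j ≤ i + r + q) → HasCard (bounceExtensions N k i (i + r) (i + r + q) g)
        (PowerSeries.coeff m (dyckSeries (k + 1) ^ (r + 1) * dyckSeries k ^ q)))
    (d : ℕ → ℕ → ℚ)
    (hd : ∀ r q, PowerSeries.coeff m (dyckSeries (k + 2) ^ (r + 1) * dyckSeries (k + 1) ^ q) =
      PowerSeries.coeff m (dyckSeries (k + 2) ^ r * dyckSeries (k + 1) ^ q) + d r q)
    (hs : ∀ (r i q : ℕ) (g : ℕ → ℕ), N = i + r + q + m → g ∈ bounceFunctions N →
      (∀ j, j < i → g j ≤ i + r + q) →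
      HasCard (bounceExtensions N (k + 1) i (i + r) (i + r + q + 1) g) (d r q))
    (r i q : ℕ) (g : ℕ → ℕ) (hN : N = i + r + q + m) (hg : g ∈ bounceFunctions N)
    (hgv : ∀ j, j < i → g j ≤ i + r + q) :
    HasCard (bounceExtensions N (k + 1) i (i + r) (i + r + q) g)
      (PowerSeries.coeff m (dyckSeries (k + 2) ^ (r + 1) * dyckSeries (k + 1) ^ q)) := by
  induction r generalizing i q g with
  | zero =>
    rw [hd, bounceExtensions_split]
    refine HasCard.union ?_ (hs 0 i q g hN hg hgv) (bounceExtensions_disjoint _ _ _ _ _ _)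
    -- Here i = e. If q = 0 then also v = i, and f i = i is possible only for i = N, that is for m =
    -- 0.
    rcases q with - | q
    · rcases m with - | m
      · have hv : i + 0 + 0 = N := by omega
        have hset : {f | f ∈ bounceExtensions N (k + 1) i (i + 0) (i + 0 + 0) g ∧
            f i = i + 0 + 0} = bounceExtensions N (k + 1) i (i + 0) N g := by
          ext f
          rw [hv]
          refine ⟨fun h => h.1, fun h => ⟨h, le_antisymm (h.1.2.2 i) (h.2.2.1 i le_rfl)⟩⟩
        rw [hset, bounceExtensions_top hg]
        · simpa using hasCard_singleton _
        · intro f hf htop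
          refine Function.iterate_fixed ?_ _ |>.trans hv
          rw [htop _ (by omega)]
          omega
      · have hset : {f | f ∈ bounceExtensions N (k + 1) i (i + 0) (i + 0 + 0) g ∧
            f i = i + 0 + 0} = ∅ := by
          ext f
          simp only [Set.mem_ofPred_eq, Set.mem_empty_iff_false, iff_false, not_and]
          intro h
          have := h.1.2.1 i (by omega)
          omega
        rw [hset]
        simpa [PowerSeries.coeff_one] using hasCard_empty
    -- The value f e = v turns f^[k+1] e into f^[k] v. The new start is v = (i + 1) + q, so q takes
    -- the role of r and the new q is 0.
    · rw [bounceExtensions_fix (k' := k) (e' := i + 1 + q)]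
      · have := ihk q (i + 1) 0 (extendBy N i (i + 0 + (q + 1)) g) (by omega)
          (extendBy_mem hg hgv (by omega) (by omega)) (by
            intro j hj
            have := hgv j
            simp only [extendBy]
            split_ifs <;> omega)
        have hv : i + 0 + (q + 1) = i + 1 + q + 0 := by omega
        rw [hv] at this ⊢
        simpa using this
      · intro f hf
        rw [Function.iterate_succ_apply, add_zero, hf]
        have hv : i + 0 + (q + 1) = i + 1 + q := by omega
        rw [hv]
  | succ r ihr =>
    rw [hd, bounceExtensions_split]
    refine HasCard.union ?_ (hs (r + 1) i q g hN hg hgv) (bounceExtensions_disjoint _ _ _ _ _ _)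
    rw [bounceExtensions_fix (k' := k + 1) (e' := i + (r + 1)) (fun f _ => Iff.rfl)]
    have := ihr (i + 1) q (extendBy N i (i + (r + 1) + q) g) (by omega)
      (extendBy_mem hg hgv (by omega) (by omega)) (by
        intro j hj
        have := hgv j
        simp only [extendBy]
        split_ifs <;> omega)
    have hv : i + 1 + r = i + (r + 1) := by omega
    rwa [hv] at this

/-- The values on [0, i) are decided, the bounce starts at e = i + r with k iterations left, and the
undecided values are at least v = e + q = N - m. Deciding f i = v lowers r, or k when r = 0; raising
v lowers m. Hence the nested induction on k, m and r. -/
theorem hasCard_bounceExtensions (k m r i q N : ℕ) (g : ℕ → ℕ) (hN : N = i + r + q + m)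
    (hg : g ∈ bounceFunctions N) (hgv : ∀ j, j < i → g j ≤ i + r + q) :
    HasCard (bounceExtensions N k i (i + r) (i + r + q) g)
      (PowerSeries.coeff m (dyckSeries (k + 1) ^ (r + 1) * dyckSeries k ^ q)) := by
  induction k generalizing m r i q g with
  | zero =>
    by_cases hmq : m = 0 ∧ q = 0
    · obtain ⟨rfl, rfl⟩ := hmq
      have h := bounceExtensions_top (k := 0) (i := i) (e := i + r) hg (by simp [hN])
      have hv : i + r + 0 = N := by omega
      rw [hv, h]
      simpa [dyckSeries_one] using hasCard_singleton _
    · have h : bounceExtensions N 0 i (i + r) (i + r + q) g = ∅ := by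
        ext f
        simp only [bounceExtensions, Set.mem_ofPred_eq, Set.mem_empty_iff_false, iff_false]
        rintro ⟨-, -, -, h⟩
        simp only [Function.iterate_zero, id_eq] at h
        omega
      rw [h]
      have hc : PowerSeries.coeff m (dyckSeries (0 + 1) ^ (r + 1) * dyckSeries 0 ^ q) = 0 := by
        rw [zero_add, dyckSeries_one, dyckSeries]
        rcases Nat.eq_zero_or_pos q with rfl | hq
        · simp only [one_pow, pow_zero, mul_one, PowerSeries.coeff_one]
          rw [if_neg (by omega)]
        · rw [zero_pow hq.ne']
          simp
      rw [hc]
      exact hasCard_empty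
  | succ k ihk =>
    induction m generalizing r i q g with
    | zero =>
      refine hasCard_bounceExtensions_step (fun r i q g => ihk 0 r i q g) (fun _ _ => 0)
        (fun r q => ?_) (fun r i q g hN hg hgv => ?_) r i q g hN hg hgv
      · rw [coeff_dyckSeries_zero, add_zero]
      · have hv : i + r + q = N := by omega
        rw [hv, bounceExtensions_add_one_eq_empty]
        exact hasCard_empty
    | succ m ihm =>
      refine hasCard_bounceExtensions_step (fun r i q g => ihk (m + 1) r i q g) _
        (fun r q => coeff_dyckSeries_succ _ r q m) (fun r i q g hN hg hgv => ?_) r i q g hN hg hgv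
      exact ihm r i (q + 1) g (by omega) hg (fun j hj => (hgv j hj).trans (Nat.le_succ _))

theorem ncard_bounceFunctions (k N : ℕ) :
    ({f | f ∈ bounceFunctions N ∧ f^[k] 0 = N}.ncard : ℚ) =
      PowerSeries.coeff N (dyckSeries (k + 1)) := by
  have hg : (fun _ => N) ∈ bounceFunctions N :=
    ⟨fun _ _ _ => le_rfl, fun _ h => h, fun _ => le_rfl⟩
  -- With i = 0 nothing is prescribed, so any bounce function serves as `g`.
  have := (hasCard_bounceExtensions k N 0 0 0 N (fun _ => N) (by omega) hg (by simp)).2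
  simpa [bounceExtensions] using this

/-! ### Closed forms of the convergents -/

lemma one_sub_X_mul_dyckSeries_two :
    (1 - PowerSeries.X) * dyckSeries 2 = 1 := by
  have := dyckSeries_succ_mul 1
  rw [dyckSeries_one] at this
  linear_combination this

lemma mul_dyckSeries_three :
    (1 - 2 * PowerSeries.X) * dyckSeries 3 = 1 - PowerSeries.X := by
  linear_combination (1 - PowerSeries.X) * dyckSeries_succ_mul 2 +
    PowerSeries.X * dyckSeries 3 * one_sub_X_mul_dyckSeries_two

lemma mul_dyckSeries_four :
    (1 - 3 * PowerSeries.X + PowerSeries.X ^ 2) * dyckSeries 4 = 1 - 2 * PowerSeries.X := by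
  linear_combination (1 - 2 * PowerSeries.X) * dyckSeries_succ_mul 3 +
    PowerSeries.X * dyckSeries 4 * mul_dyckSeries_three

lemma mul_dyckSeries_five :
    (1 - 4 * PowerSeries.X + 3 * PowerSeries.X ^ 2) * dyckSeries 5 =
      1 - 3 * PowerSeries.X + PowerSeries.X ^ 2 := by
  linear_combination (1 - 3 * PowerSeries.X + PowerSeries.X ^ 2) * dyckSeries_succ_mul 4 +
    PowerSeries.X * dyckSeries 5 * mul_dyckSeries_four

/-- The odd-indexed Fibonacci numbers satisfy u (n+2) = 3 u (n+1) - u n, which is the denominator 1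
- 3X + X². As `Nat.fib` starts from 0, `Nat.fib (2 * n + 1)` is F_{2n} for F_0 = F_1 = 1. -/
lemma coeff_dyckSeries_four (n : ℕ) :
    PowerSeries.coeff (n + 1) (dyckSeries 4) = Nat.fib (2 * n + 1) := by
  have key : dyckSeries 4 = 1 + PowerSeries.X *
      PowerSeries.mk (fun n => (Nat.fib (2 * n + 1) : ℚ)) := by
    have hne : (1 - 3 * PowerSeries.X + PowerSeries.X ^ 2 : PowerSeries ℚ) ≠ 0 := by
      intro h
      simpa using congrArg PowerSeries.constantCoeff h
    refine mul_left_cancel₀ hne (mul_dyckSeries_four.trans ?_)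
    set F : PowerSeries ℚ := PowerSeries.mk (fun n => (Nat.fib (2 * n + 1) : ℚ)) with hF
    have hrec : (1 - 3 * PowerSeries.X + PowerSeries.X ^ 2) * F = 1 - PowerSeries.X := by
      have : F + PowerSeries.X * (PowerSeries.X * F) =
          1 - PowerSeries.X + PowerSeries.C (3 : ℚ) * (PowerSeries.X * F) := by
        ext m
        rcases m with - | - | m
        · simp [hF]
        · simp [hF, PowerSeries.coeff_succ_X_mul, PowerSeries.coeff_one, PowerSeries.coeff_X,
            Nat.fib_add_two]
          norm_num
        · simp only [hF, map_add, map_sub, PowerSeries.coeff_succ_X_mul, PowerSeries.coeff_C_mul,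
            PowerSeries.coeff_mk, PowerSeries.coeff_one, PowerSeries.coeff_X]
          have h (a : ℕ) : (Nat.fib (a + 4) : ℚ) + Nat.fib a = 3 * Nat.fib (a + 2) := by
            rw [Nat.fib_add_two (n := a + 2), Nat.fib_add_two (n := a + 1),
              Nat.fib_add_two (n := a)]
            push_cast
            ring
          have := h (2 * m + 1)
          simpa [mul_add, add_right_comm _ _ 1] using this
      have hC : PowerSeries.C (3 : ℚ) = 3 := map_ofNat _ 3
      rw [hC] at this
      linear_combination this
    linear_combination -PowerSeries.X * hrec
  rw [key, map_add, PowerSeries.coeff_succ_X_mul, PowerSeries.coeff_mk, PowerSeries.coeff_one]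
  simp

/-- The denominator factors as (1 - X)(1 - 3X), so the coefficients combine 1 and 3 ^ n. -/
lemma coeff_dyckSeries_five (n : ℕ) :
    PowerSeries.coeff (n + 1) (dyckSeries 5) = (3 ^ n + 1) / 2 := by
  have key : dyckSeries 5 = 1 + PowerSeries.X *
      PowerSeries.mk (fun n => ((3 ^ n + 1) / 2 : ℚ)) := by
    have hne : (1 - 4 * PowerSeries.X + 3 * PowerSeries.X ^ 2 : PowerSeries ℚ) ≠ 0 := by
      intro h
      simpa using congrArg PowerSeries.constantCoeff h
    refine mul_left_cancel₀ hne (mul_dyckSeries_five.trans ?_)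
    set F : PowerSeries ℚ := PowerSeries.mk (fun n => ((3 ^ n + 1) / 2 : ℚ)) with hF
    have hrec : (1 - 4 * PowerSeries.X + 3 * PowerSeries.X ^ 2) * F = 1 - 2 * PowerSeries.X := by
      have : F + PowerSeries.C (3 : ℚ) * (PowerSeries.X * (PowerSeries.X * F)) =
          1 - PowerSeries.C (2 : ℚ) * PowerSeries.X
            + PowerSeries.C (4 : ℚ) * (PowerSeries.X * F) := by
        ext m
        rcases m with - | - | m
        · simp [hF]
        · simp [hF, PowerSeries.coeff_succ_X_mul, PowerSeries.coeff_one]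
          norm_num
        · simp only [hF, map_add, map_sub, PowerSeries.coeff_succ_X_mul, PowerSeries.coeff_C_mul,
            PowerSeries.coeff_mk, PowerSeries.coeff_one, PowerSeries.coeff_X]
          simp
          ring
      have h3 : PowerSeries.C (3 : ℚ) = 3 := map_ofNat _ 3
      have h2 : PowerSeries.C (2 : ℚ) = 2 := map_ofNat _ 2
      have h4 : PowerSeries.C (4 : ℚ) = 4 := map_ofNat _ 4
      rw [h2, h3, h4] at this
      linear_combination this
    linear_combination -PowerSeries.X * hrec
  rw [key, map_add, PowerSeries.coeff_succ_X_mul, PowerSeries.coeff_mk, PowerSeries.coeff_one]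
  simp

end AdNilpotentIdeals

/-! ### Matrix charts and elementary matrices -/

namespace AdNilpotentIdeals

variable {L : Type*} [LieRing L] [LieAlgebra ℂ L] {N : ℕ}

/-- An identification of the Lie algebra `L` with the traceless `N × N` matrices. -/
structure MatrixChart (L : Type*) [LieRing L] [LieAlgebra ℂ L] (N : ℕ) where
  toLin : L →ₗ[ℂ] Matrix (Fin N) (Fin N) ℂ
  injective : Function.Injective toLin
  trace_eq_zero : ∀ x, (toLin x).trace = 0
  exists_eq : ∀ M, M.trace = 0 → ∃ x, toLin x = M
  map_lie : ∀ x y, toLin ⁅x, y⁆ = toLin x * toLin y - toLin y * toLin x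

namespace MatrixChart

variable (φ : MatrixChart L N)

/-- The element of `L` whose matrix is the elementary matrix `E i j`, for `i ≠ j`. -/
noncomputable def unit (i j : Fin N) : L :=
  (φ.exists_eq (if i = j then 0 else Matrix.single i j 1) (by
    split_ifs with h
    · simp
    · exact Matrix.trace_single_eq_of_ne _ _ _ h)).choose

lemma toLin_unit {i j : Fin N} (h : i ≠ j) : φ.toLin (φ.unit i j) = Matrix.single i j 1 := by
  have := (φ.exists_eq (if i = j then 0 else Matrix.single i j 1) (by
    split_ifs with h
    · simp
    · exact Matrix.trace_single_eq_of_ne _ _ _ h)).choose_spec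
  exact this.trans (if_neg h)

lemma map_lie_apply (x y : L) (i j : Fin N) :
    φ.toLin ⁅x, y⁆ i j =
      ∑ m, φ.toLin x i m * φ.toLin y m j - ∑ m, φ.toLin y i m * φ.toLin x m j := by
  rw [φ.map_lie, Matrix.sub_apply, Matrix.mul_apply, Matrix.mul_apply]

lemma exists_of_map_lie_ne_zero {x y : L} {i j : Fin N} (h : φ.toLin ⁅x, y⁆ i j ≠ 0) :
    (∃ m, φ.toLin x i m ≠ 0 ∧ φ.toLin y m j ≠ 0) ∨
      ∃ m, φ.toLin y i m ≠ 0 ∧ φ.toLin x m j ≠ 0 := by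
  by_contra! hc
  apply h
  rw [map_lie_apply, Finset.sum_eq_zero, Finset.sum_eq_zero, sub_zero]
  · intro m _
    by_cases hm : φ.toLin y i m = 0
    · rw [hm, zero_mul]
    · rw [hc.2 m hm, mul_zero]
  · intro m _
    by_cases hm : φ.toLin x i m = 0
    · rw [hm, zero_mul]
    · rw [hc.1 m hm, mul_zero]

lemma unit_lie_unit {i j k : Fin N} (hij : i ≠ j) (hjk : j ≠ k) (hik : i ≠ k) :
    ⁅φ.unit i j, φ.unit j k⁆ = φ.unit i k := by
  apply φ.injective
  rw [φ.map_lie, toLin_unit _ hij, toLin_unit _ hjk, toLin_unit _ hik,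
    Matrix.single_mul_single_same, Matrix.single_mul_single_of_ne _ _ _ _ hik.symm]
  simp

/-- An element with vanishing diagonal lies in any subspace that contains the elementary matrices of
its support. -/
lemma mem_of_unit_mem {S : Submodule ℂ L} {x : L} (hx : ∀ i, φ.toLin x i i = 0)
    (h : ∀ i j, i ≠ j → φ.toLin x i j ≠ 0 → φ.unit i j ∈ S) : x ∈ S := by
  have key : x = ∑ i, ∑ j, φ.toLin x i j • φ.unit i j := by
    apply φ.injective
    conv_lhs => rw [Matrix.matrix_eq_sum_single (φ.toLin x)]
    simp only [map_sum, map_smul]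
    refine Finset.sum_congr rfl fun i _ => Finset.sum_congr rfl fun j _ => ?_
    by_cases hij : i = j
    · subst hij
      simp [hx]
    · rw [toLin_unit _ hij, Matrix.smul_single, smul_eq_mul, mul_one]
  rw [key]
  refine Submodule.sum_mem _ fun i _ => Submodule.sum_mem _ fun j _ => ?_
  by_cases hij : i = j
  · subst hij
    simp [hx]
  · by_cases h0 : φ.toLin x i j = 0
    · simp [h0]
    · exact S.smul_mem _ (h i j hij h0)

/-- The element of `L` whose matrix is `E i i` minus a scalar. -/
lemma exists_diagonal [NeZero N] (i : Fin N) :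
    ∃ h : L, ∃ c : ℂ, φ.toLin h = Matrix.diagonal (fun a => (if a = i then 1 else 0) - c) := by
  have hN : (N : ℂ) ≠ 0 := by exact_mod_cast NeZero.ne N
  obtain ⟨h, hh⟩ := φ.exists_eq
    (Matrix.diagonal (fun a => (if a = i then (1 : ℂ) else 0) - (N : ℂ)⁻¹)) (by
      rw [Matrix.trace_diagonal, Finset.sum_sub_distrib]
      simp [hN])
  exact ⟨h, _, hh⟩

lemma map_diagonal_lie_apply {h : L} {d : Fin N → ℂ} (hh : φ.toLin h = Matrix.diagonal d) (x : L)
    (i j : Fin N) : φ.toLin ⁅h, x⁆ i j = (d i - d j) * φ.toLin x i j := by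
  rw [φ.map_lie, hh, Matrix.sub_apply, Matrix.diagonal_mul, Matrix.mul_diagonal]
  ring

/-- A subspace stable under the diagonal matrices contains the elementary matrices of the supports
of its elements. -/
lemma unit_mem_of_diagonal_stable {S : Submodule ℂ L}
    (hS : ∀ h x : L, (∃ d, φ.toLin h = Matrix.diagonal d) → x ∈ S → ⁅h, x⁆ ∈ S)
    {x : L} (hx : x ∈ S) {i j : Fin N} (hij : i ≠ j) (hne : φ.toLin x i j ≠ 0) :
    φ.unit i j ∈ S := by
  have : NeZero N := ⟨fun h => by subst h; exact i.elim0⟩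
  obtain ⟨h, c, hh⟩ := φ.exists_diagonal i
  obtain ⟨k, c', hk⟩ := φ.exists_diagonal j
  -- On the entry (a, b), ad h is the scalar t = δ_ai - δ_bi, and t² + t is 2 for t = 1 and 0 for t
  -- = 0, -1. Likewise ad k has t = -1 at (i, j), where t² - t is 2, and t² - t vanishes at 0 and 1.
  -- Together they leave 4 x_ij E i j.
  have hz : ⁅h, ⁅h, x⁆⁆ + ⁅h, x⁆ ∈ S :=
    S.add_mem (hS _ _ ⟨_, hh⟩ (hS _ _ ⟨_, hh⟩ hx)) (hS _ _ ⟨_, hh⟩ hx)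
  set z := ⁅h, ⁅h, x⁆⁆ + ⁅h, x⁆ with hzdef
  have hw : ⁅k, ⁅k, z⁆⁆ - ⁅k, z⁆ ∈ S :=
    S.sub_mem (hS _ _ ⟨_, hk⟩ (hS _ _ ⟨_, hk⟩ hz)) (hS _ _ ⟨_, hk⟩ hz)
  have key : φ.unit i j = (4 * φ.toLin x i j)⁻¹ • (⁅k, ⁅k, z⁆⁆ - ⁅k, z⁆) := by
    apply φ.injective
    rw [toLin_unit _ hij, map_smul]
    ext a b
    rw [Matrix.smul_apply, map_sub, Matrix.sub_apply, map_diagonal_lie_apply _ hk,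
      map_diagonal_lie_apply _ hk, hzdef, map_add, Matrix.add_apply, map_diagonal_lie_apply _ hh,
      map_diagonal_lie_apply _ hh, Matrix.single_apply]
    by_cases hai : a = i
    · subst hai
      by_cases hbj : b = j
      · subst hbj
        simp [hij, hij.symm]
        field_simp
        ring
      · by_cases hba : b = a
        · subst hba
          simp [hij.symm]
        · simp [hij, hba, hbj, Ne.symm hbj]
    · by_cases hbi : b = i
      · subst hbi
        simp only [hai, if_true, if_false]
        ring_nf
        simp [Ne.symm hai]
      · simp [hai, hbi, Ne.symm hai]
  rw [key]
  exact S.smul_mem _ hw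

end MatrixChart

end AdNilpotentIdeals

/-! ### Ad-nilpotent ideals of an upper triangular algebra as bounce functions -/

namespace AdNilpotentIdeals

lemma apply_eq_of_mem_bounceFunctions {N a : ℕ} {f : ℕ → ℕ} (hf : f ∈ bounceFunctions N)
    (ha : N ≤ a) : f a = N := by
  refine le_antisymm (hf.2.2 a) ?_
  rcases Nat.eq_zero_or_pos N with h | h
  · omega
  · have := hf.2.1 (N - 1) (by omega)
    have := hf.1 (show N - 1 ≤ a by omega)
    omega

lemma le_iterate_of_mem_bounceFunctions {N : ℕ} {f : ℕ → ℕ} (hf : f ∈ bounceFunctions N) (k : ℕ)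
    (a : ℕ) : min N (a + k) ≤ f^[k] a := by
  induction k with
  | zero => simp
  | succ k ih =>
    rw [Function.iterate_succ_apply']
    by_cases h : f^[k] a < N
    · have := hf.2.1 _ h
      omega
    · rw [apply_eq_of_mem_bounceFunctions hf (not_lt.1 h)]
      omega

lemma iterate_le_of_mem_bounceFunctions {N : ℕ} {f : ℕ → ℕ} (hf : f ∈ bounceFunctions N) (k : ℕ)
    {a : ℕ} (ha : a ≤ N) : f^[k] a ≤ N := by
  cases k with
  | zero => simpa
  | succ k => rw [Function.iterate_succ_apply']; exact hf.2.2 _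

variable {L : Type*} [LieRing L] [LieAlgebra ℂ L] {N : ℕ}

/-- The Lie subalgebra `B` consists of the elements with upper triangular matrix. -/
def MatrixChart.IsUpper (φ : MatrixChart L N) (B : LieSubalgebra ℂ L) : Prop :=
  ∀ x, x ∈ B ↔ ∀ i j, j < i → φ.toLin x i j = 0

namespace MatrixChart

variable {φ : MatrixChart L N} {B : LieSubalgebra ℂ L}

lemma IsUpper.unit_mem (hB : φ.IsUpper B) {i j : Fin N} (hij : i < j) : φ.unit i j ∈ B := by
  rw [hB]
  intro a b hab
  rw [φ.toLin_unit hij.ne, Matrix.single_apply, if_neg]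
  rintro ⟨rfl, rfl⟩
  exact absurd hab hij.le.not_gt

lemma IsUpper.diagonal_mem (hB : φ.IsUpper B) {h : L} {d : Fin N → ℂ}
    (hh : φ.toLin h = Matrix.diagonal d) : h ∈ B := by
  rw [hB]
  intro a b hab
  rw [hh, Matrix.diagonal_apply_ne _ hab.ne']

lemma IsUpper.le_of_ne_zero (hB : φ.IsUpper B) {x : L} (hx : x ∈ B) {i j : Fin N}
    (h : φ.toLin x i j ≠ 0) : i ≤ j := by
  by_contra! hc
  exact h ((hB x).1 hx i j hc)

/-- An upper triangular matrix with nilpotent adjoint action has vanishing diagonal. -/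
lemma IsUpper.diag_eq_zero (hB : φ.IsUpper B) {x : L} (hx : x ∈ B)
    (hnil : IsNilpotent (LieAlgebra.ad ℂ L x)) (i : Fin N) : φ.toLin x i i = 0 := by
  have hlt : ∀ i j : Fin N, j < i → φ.toLin x i i = φ.toLin x j j := by
    intro i j hji
    -- Applied to E i j below the diagonal, ad x spreads the support only upwards and to the right,
    -- so the corner (i, j) is an eigenvector entry with eigenvalue x_ii - x_jj. Nilpotency makes
    -- the diagonal constant, and the trace makes it zero.
    have key : ∀ k : ℕ, (∀ a b, φ.toLin ((LieAlgebra.ad ℂ L x ^ k) (φ.unit i j)) a b ≠ 0 →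
        a ≤ i ∧ j ≤ b) ∧ φ.toLin ((LieAlgebra.ad ℂ L x ^ k) (φ.unit i j)) i j =
          (φ.toLin x i i - φ.toLin x j j) ^ k := by
      intro k
      induction k with
      | zero =>
        simp only [pow_zero, Module.End.one_apply, φ.toLin_unit hji.ne', Matrix.single_apply]
        refine ⟨fun a b h => ?_, by simp⟩
        have : i = a ∧ j = b := by
          by_contra hc
          simp [hc] at h
        exact ⟨this.1.ge, this.2.le⟩
      | succ k ih =>
        rw [pow_succ', Module.End.mul_apply, LieAlgebra.ad_apply]
        set y := (LieAlgebra.ad ℂ L x ^ k) (φ.unit i j)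
        constructor
        · intro a b h
          rcases φ.exists_of_map_lie_ne_zero h with ⟨m, h1, h2⟩ | ⟨m, h1, h2⟩
          · exact ⟨(hB.le_of_ne_zero hx h1).trans (ih.1 _ _ h2).1, (ih.1 _ _ h2).2⟩
          · exact ⟨(ih.1 _ _ h1).1, (ih.1 _ _ h1).2.trans (hB.le_of_ne_zero hx h2)⟩
        · rw [map_lie_apply, Finset.sum_eq_single i, Finset.sum_eq_single j, ih.2, pow_succ]
          · ring
          · intro m _ hm
            by_contra hc
            have h1 := left_ne_zero_of_mul hc
            have h2 := right_ne_zero_of_mul hc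
            exact hm (le_antisymm (hB.le_of_ne_zero hx h2) (ih.1 _ _ h1).2)
          · simp
          · intro m _ hm
            by_contra hc
            have h1 := left_ne_zero_of_mul hc
            have h2 := right_ne_zero_of_mul hc
            exact hm (le_antisymm (ih.1 _ _ h2).1 (hB.le_of_ne_zero hx h1))
          · simp
    obtain ⟨k, hk⟩ := hnil
    have := (key k).2
    rw [hk] at this
    simp only [LinearMap.zero_apply, map_zero, Matrix.zero_apply] at this
    exact sub_eq_zero.1 (eq_zero_of_pow_eq_zero this.symm)
  have hall : ∀ j, φ.toLin x j j = φ.toLin x i i := by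
    intro j
    rcases lt_trichotomy i j with h | h | h
    · exact hlt _ _ h
    · rw [h]
    · exact (hlt _ _ h).symm
  have htr := φ.trace_eq_zero x
  have hN : (N : ℂ) ≠ 0 := by
    have := i.pos
    exact_mod_cast this.ne'
  simpa [Matrix.trace, hall, hN] using htr

/-- The ideal of the matrices supported in the region weakly above the graph of `f`. -/
def supportIdeal (φ : MatrixChart L N) (hB : φ.IsUpper B) {f : ℕ → ℕ} (hf : Monotone f) :
    LieIdeal ℂ B where
  carrier := {x | ∀ i j : Fin N, φ.toLin (x : L) i j ≠ 0 → f i ≤ j}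
  zero_mem' := by simp
  add_mem' := by
    intro x y hx hy i j h
    by_cases h1 : φ.toLin (x : L) i j = 0
    · refine hy i j fun h2 => h ?_
      simp [h1, h2]
    · exact hx i j h1
  smul_mem' := by
    intro c x hx i j h
    refine hx i j fun h1 => h ?_
    simp [h1]
  lie_mem := by
    intro b x hx i j h
    rcases φ.exists_of_map_lie_ne_zero h with ⟨m, h1, h2⟩ | ⟨m, h1, h2⟩
    · exact (hf (hB.le_of_ne_zero b.2 h1)).trans (hx m j h2)
    · exact (hx i m h1).trans (hB.le_of_ne_zero b.2 h2)

lemma mem_supportIdeal (hB : φ.IsUpper B) {f : ℕ → ℕ} (hf : Monotone f) (x : B) :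
    x ∈ φ.supportIdeal hB hf ↔ ∀ i j : Fin N, φ.toLin (x : L) i j ≠ 0 → f i ≤ j := Iff.rfl

lemma unit_mem_supportIdeal (hB : φ.IsUpper B) {f : ℕ → ℕ} (hf : Monotone f) {i j : Fin N}
    (hij : i < j) : (⟨φ.unit i j, hB.unit_mem hij⟩ : B) ∈ φ.supportIdeal hB hf ↔ f i ≤ j := by
  rw [mem_supportIdeal]
  simp only [φ.toLin_unit hij.ne, Matrix.single_apply]
  constructor
  · intro h
    exact h i j (by simp)
  · intro h a b hab
    have : i = a ∧ j = b := by
      by_contra hc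
      simp [hc] at hab
    rw [← this.1, ← this.2]
    exact h

lemma supportIdeal_injective (hB : φ.IsUpper B) {f g : ℕ → ℕ} (hf : f ∈ bounceFunctions N)
    (hg : g ∈ bounceFunctions N)
    (h : φ.supportIdeal hB hf.1 = φ.supportIdeal hB hg.1) : f = g := by
  have key : ∀ {f g : ℕ → ℕ} (hf : f ∈ bounceFunctions N) (hg : g ∈ bounceFunctions N),
      φ.supportIdeal hB hf.1 = φ.supportIdeal hB hg.1 → ∀ a, g a ≤ f a := by
    intro f g hf hg h a
    by_cases ha : f a < N
    · have haN : a < N := by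
        by_contra hc
        rw [apply_eq_of_mem_bounceFunctions hf (not_lt.1 hc)] at ha
        exact lt_irrefl _ ha
      have hlt : (⟨a, haN⟩ : Fin N) < ⟨f a, ha⟩ := hf.2.1 a haN
      have := (unit_mem_supportIdeal hB hf.1 hlt).2 le_rfl
      rw [h] at this
      exact (unit_mem_supportIdeal hB hg.1 hlt).1 this
    · exact (hg.2.2 a).trans (not_lt.1 ha)
  funext a
  exact le_antisymm (key hg hf h.symm a) (key hf hg h a)

lemma isAdNilpotent_supportIdeal (hB : φ.IsUpper B) {f : ℕ → ℕ} (hf : f ∈ bounceFunctions N) :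
    IsAdNilpotent (φ.supportIdeal hB hf.1) := by
  intro x hx
  rw [mem_supportIdeal] at hx
  have hlt : ∀ i j : Fin N, φ.toLin (x : L) i j ≠ 0 → (i : ℕ) < j :=
    fun i j h => (hf.2.1 i i.2).trans_le (hx i j h)
  -- Each bracket with the strictly upper triangular x moves the support at least one diagonal up;
  -- after 2N brackets none of the N × N square is left.
  have key : ∀ (k : ℕ) (y : L) (a b : Fin N),
      φ.toLin ((LieAlgebra.ad ℂ L (x : L) ^ k) y) a b ≠ 0 → (a : ℕ) + k ≤ b + N := by
    intro k y
    induction k with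
    | zero => intro a b _; omega
    | succ k ih =>
      intro a b h
      rw [pow_succ', Module.End.mul_apply, LieAlgebra.ad_apply] at h
      rcases φ.exists_of_map_lie_ne_zero h with ⟨m, h1, h2⟩ | ⟨m, h1, h2⟩
      · have := hlt _ _ h1
        have := ih _ _ h2
        omega
      · have := hlt _ _ h2
        have := ih _ _ h1
        omega
  refine ⟨2 * N, LinearMap.ext fun y => φ.injective ?_⟩
  ext a b
  rw [LinearMap.zero_apply, map_zero, Matrix.zero_apply]
  by_contra h
  have := key _ _ _ _ h
  omega

/-- The ideal is spanned by the elementary matrices it contains, and brackets with E i' i and E j j'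
close their positions upwards and to the right. The function f a is the least column met by the
ideal in the rows from a on. -/
lemma exists_eq_supportIdeal (hB : φ.IsUpper B) {I : LieIdeal ℂ B} (hI : IsAdNilpotent I) :
    ∃ f, ∃ hf : f ∈ bounceFunctions N, φ.supportIdeal hB hf.1 = I := by
  have hstrict : ∀ x ∈ I, ∀ i j : Fin N, φ.toLin (x : L) i j ≠ 0 → i < j := by
    intro x hx i j h
    refine lt_of_le_of_ne (hB.le_of_ne_zero x.2 h) ?_
    rintro rfl
    exact h (hB.diag_eq_zero x.2 (hI x hx) i)
  let S : Submodule ℂ L := I.toSubmodule.map B.toSubmodule.subtype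
  have hmemS : ∀ x : B, (x : L) ∈ S ↔ x ∈ I := by
    intro x
    constructor
    · rintro ⟨y, hy, hyx⟩
      have : y = x := Subtype.ext hyx
      rwa [← this]
    · intro h
      exact ⟨x, h, rfl⟩
  have hstable : ∀ b : B, ∀ x ∈ S, ⁅(b : L), x⁆ ∈ S := by
    rintro b x ⟨y, hy, rfl⟩
    exact ⟨⁅b, y⁆, I.lie_mem hy, rfl⟩
  have hunit : ∀ x ∈ I, ∀ i j : Fin N, φ.toLin (x : L) i j ≠ 0 → φ.unit i j ∈ S := by
    intro x hx i j h
    refine φ.unit_mem_of_diagonal_stable ?_ ((hmemS x).2 hx) (hstrict x hx i j h).ne h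
    rintro k y ⟨d, hd⟩ hy
    exact hstable ⟨k, hB.diagonal_mem hd⟩ y hy
  have hup : ∀ i j i' j' : Fin N, i < j → φ.unit i j ∈ S → i' ≤ i → j ≤ j' →
      φ.unit i' j' ∈ S := by
    intro i j i' j' hij h hi hj
    have h1 : φ.unit i' j ∈ S := by
      rcases hi.eq_or_lt with rfl | hi
      · exact h
      · rw [← φ.unit_lie_unit hi.ne hij.ne (hi.trans hij).ne]
        exact hstable ⟨_, hB.unit_mem hi⟩ _ h
    rcases hj.eq_or_lt with rfl | hj
    · exact h1
    · have hi' := hi.trans_lt hij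
      rw [← φ.unit_lie_unit hi'.ne hj.ne (hi'.trans hj).ne, ← lie_skew]
      exact S.neg_mem (hstable ⟨_, hB.unit_mem hj⟩ _ h1)
  -- The member N is the value of f where the ideal has no entry in the rows from a on.
  let T : ℕ → Set ℕ := fun a => {b | b = N ∨ ∃ i j : Fin N, a ≤ i ∧ (j : ℕ) = b ∧
    ∃ x ∈ I, φ.toLin (x : L) i j ≠ 0}
  have hT : ∀ a, (T a).Nonempty := fun a => ⟨N, Or.inl rfl⟩
  have hTN : ∀ a, sInf (T a) ≤ N := fun a => Nat.sInf_le (Or.inl rfl)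
  have hf : (fun a => sInf (T a)) ∈ bounceFunctions N := by
    refine ⟨fun a b hab => ?_, fun a ha => ?_, hTN⟩
    · refine Nat.sInf_le ?_
      rcases Nat.sInf_mem (hT b) with h | ⟨i, j, h1, h2⟩
      · exact Or.inl h
      · exact Or.inr ⟨i, j, hab.trans h1, h2⟩
    · change a < sInf (T a)
      rcases Nat.sInf_mem (hT a) with h | ⟨i, j, h1, h2, x, hx, hne⟩
      · rwa [h]
      · rw [← h2]
        exact h1.trans_lt (hstrict x hx i j hne)
  refine ⟨_, hf, ?_⟩
  ext x
  rw [mem_supportIdeal]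
  constructor
  · intro hx
    rw [← hmemS]
    refine φ.mem_of_unit_mem (fun i => ?_) (fun i j hij hne => ?_)
    · by_contra h
      exact absurd (hx i i h) (hf.2.1 i i.2).not_ge
    · have hle := hx i j hne
      rcases Nat.sInf_mem (hT i) with h | ⟨i', j', h1, h2, y, hy, hne'⟩
      · rw [h] at hle
        exact absurd j.2 hle.not_gt
      · rw [← h2] at hle
        exact hup i' j' i j (hstrict y hy i' j' hne') (hunit y hy i' j' hne') h1 hle
  · intro hx i j hne
    exact Nat.sInf_le (Or.inr ⟨i, j, le_rfl, rfl, x, hx, hne⟩)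

/-- A nonzero entry of a bracket passes through some m, with one factor in the ideal and the other
in the previous term; in either order the bounds compose to one more iterate of f. -/
lemma lowerCentralSeries_supportIdeal_le (hB : φ.IsUpper B) {f : ℕ → ℕ} (hf : Monotone f) (k : ℕ)
    (x : φ.supportIdeal hB hf)
    (hx : x ∈ LieModule.lowerCentralSeries ℂ (φ.supportIdeal hB hf) (φ.supportIdeal hB hf) k)
    (i j : Fin N) (h : φ.toLin ((x : B) : L) i j ≠ 0) : f^[k + 1] i ≤ j := by
  induction k generalizing x i j with
  | zero => exact x.2 i j h
  | succ k ih =>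
    rw [LieModule.lowerCentralSeries_succ, ← LieSubmodule.mem_toSubmodule,
      LieSubmodule.lieIdeal_oper_eq_linear_span] at hx
    induction hx using Submodule.span_induction generalizing i j with
    | mem z hz =>
      obtain ⟨a, b, rfl⟩ := hz
      rcases φ.exists_of_map_lie_ne_zero h with ⟨m, h1, h2⟩ | ⟨m, h1, h2⟩
      · have h3 := a.1.2 i m h1
        have h4 := ih b.1 b.2 m j h2
        rw [Function.iterate_succ_apply]
        exact (hf.iterate _ h3).trans h4
      · have h3 := a.1.2 m j h2
        have h4 := ih b.1 b.2 i m h1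
        rw [Function.iterate_succ_apply']
        exact (hf h4).trans h3
    | zero => simp at h
    | add y z _ _ hy hz =>
      by_cases h1 : φ.toLin ((y : B) : L) i j = 0
      · refine hz i j fun h2 => h ?_
        simp [h1, h2]
      · exact hy i j h1
    | smul c y _ hy =>
      refine hy i j fun h1 => h ?_
      simp [h1]

/-- Write E i j as the bracket of E i (f i), which lies in the ideal, with E (f i) j, which lies in
the previous term. -/
lemma unit_mem_lowerCentralSeries (hB : φ.IsUpper B) {f : ℕ → ℕ} (hf : f ∈ bounceFunctions N)
    (k : ℕ) (i j : Fin N) (hij : i < j) (h : f^[k + 1] i ≤ j) :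
    ∃ x ∈ LieModule.lowerCentralSeries ℂ (φ.supportIdeal hB hf.1) (φ.supportIdeal hB hf.1) k,
      ((x : B) : L) = φ.unit i j := by
  induction k generalizing i j with
  | zero =>
    exact ⟨⟨_, (unit_mem_supportIdeal hB hf.1 hij).2 h⟩, by simp, rfl⟩
  | succ k ih =>
    rw [Function.iterate_succ_apply] at h
    have h1 : f i ≤ N := hf.2.2 i
    have h2 := le_iterate_of_mem_bounceFunctions hf (k + 1) (f i)
    have h3 : f i < j := by omega
    let m : Fin N := ⟨f i, h3.trans j.2⟩
    have him : i < m := hf.2.1 i i.2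
    have hmj : m < j := h3
    obtain ⟨y, hy, hy'⟩ := ih m j hmj h
    refine ⟨⁅(⟨_, (unit_mem_supportIdeal hB hf.1 him).2 le_rfl⟩ : φ.supportIdeal hB hf.1), y⁆,
      ?_, ?_⟩
    · rw [LieModule.lowerCentralSeries_succ]
      exact LieSubmodule.lie_mem_lie (LieSubmodule.mem_top _) hy
    · rw [← φ.unit_lie_unit him.ne hmj.ne hij.ne, ← hy']
      rfl

end MatrixChart

/-- The length is an infimum over the lower central series taken over ℤ. The infimum of the empty
set is 0, hence the hypothesis `hM`. -/
lemma nilpotencyLength_le_iff {M : Type*} [LieRing M] [LieAlgebra ℂ M]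
    (hM : ∃ k, LieModule.lowerCentralSeries ℂ M M k = ⊥) (m : ℕ) :
    LieModule.nilpotencyLength M M ≤ m ↔ LieModule.lowerCentralSeries ℂ M M m = ⊥ := by
  have aux (k : ℕ) : LieModule.lowerCentralSeries ℂ M M k = ⊥ ↔
      LieModule.lowerCentralSeries ℤ M M k = ⊥ := by
    simp [SetLike.ext'_iff, LieModule.coe_lowerCentralSeries_eq_int ℂ M M]
  simp only [aux] at hM ⊢
  constructor
  · intro h
    have h1 : LieModule.lowerCentralSeries ℤ M M (LieModule.nilpotencyLength M M) = ⊥ :=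
      Nat.sInf_mem (s := {k | LieModule.lowerCentralSeries ℤ M M k = ⊥}) hM
    exact eq_bot_iff.2 (h1 ▸ LieModule.antitone_lowerCentralSeries ℤ M M h)
  · intro h
    exact Nat.sInf_le (s := {k | LieModule.lowerCentralSeries ℤ M M k = ⊥}) h

namespace MatrixChart

variable {φ : MatrixChart L N} {B : LieSubalgebra ℂ L}

/-- By monotonicity the top row has the smallest iterate, so E 0 (f^[k+1] 0) is present whenever
anything is. -/
lemma lowerCentralSeries_supportIdeal_eq_bot_iff [NeZero N] (hB : φ.IsUpper B) {f : ℕ → ℕ}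
    (hf : f ∈ bounceFunctions N) (k : ℕ) :
    LieModule.lowerCentralSeries ℂ (φ.supportIdeal hB hf.1) (φ.supportIdeal hB hf.1) k = ⊥ ↔
      f^[k + 1] 0 = N := by
  constructor
  · intro h
    by_contra hne
    have hlt : f^[k + 1] 0 < N :=
      lt_of_le_of_ne (iterate_le_of_mem_bounceFunctions hf _ (Nat.zero_le N)) hne
    have hpos := le_iterate_of_mem_bounceFunctions hf (k + 1) 0
    have hij : (0 : Fin N) < ⟨_, hlt⟩ := by
      rw [Fin.lt_def, Fin.val_zero]
      change 0 < f^[k + 1] 0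
      omega
    obtain ⟨x, hx, hx'⟩ := unit_mem_lowerCentralSeries hB hf k 0 ⟨_, hlt⟩ hij (by simp)
    rw [h, LieSubmodule.mem_bot] at hx
    have h0 : φ.toLin (φ.unit 0 ⟨_, hlt⟩) = 0 := by
      rw [← hx', hx]
      simp
    rw [φ.toLin_unit hij.ne] at h0
    simpa using congrFun (congrFun h0 0) ⟨_, hlt⟩
  · intro h
    rw [eq_bot_iff]
    intro x hx
    rw [LieSubmodule.mem_bot]
    refine Subtype.ext (Subtype.ext (φ.injective ?_))
    ext i j
    by_contra hne
    have h1 := lowerCentralSeries_supportIdeal_le hB hf.1 k x hx i j (by simpa using hne)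
    have h2 := hf.1.iterate (k + 1) (Nat.zero_le (i : ℕ))
    omega

lemma nilpotenceClass_supportIdeal_le_iff [NeZero N] (hB : φ.IsUpper B) {f : ℕ → ℕ}
    (hf : f ∈ bounceFunctions N) (m : ℕ) :
    nilpotenceClass (φ.supportIdeal hB hf.1) ≤ m ↔ f^[m + 1] 0 = N := by
  rw [nilpotenceClass, nilpotencyLength_le_iff,
    lowerCentralSeries_supportIdeal_eq_bot_iff hB hf m]
  refine ⟨N, (lowerCentralSeries_supportIdeal_eq_bot_iff hB hf N).2 ?_⟩
  have h1 := le_iterate_of_mem_bounceFunctions hf (N + 1) 0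
  have h2 := iterate_le_of_mem_bounceFunctions hf (N + 1) (Nat.zero_le N)
  omega

theorem ncard_isAdNilpotent_nilpotenceClass_le [NeZero N] (hB : φ.IsUpper B) (m : ℕ) :
    {I : LieIdeal ℂ B | IsAdNilpotent I ∧ nilpotenceClass I ≤ m}.ncard =
      {f | f ∈ bounceFunctions N ∧ f^[m + 1] 0 = N}.ncard := by
  symm
  refine Set.ncard_congr (fun f hf => φ.supportIdeal hB hf.1.1) ?_ ?_ ?_
  · intro f hf
    exact ⟨isAdNilpotent_supportIdeal hB hf.1,
      (nilpotenceClass_supportIdeal_le_iff hB hf.1 m).2 hf.2⟩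
  · intro f g hf hg h
    exact supportIdeal_injective hB hf.1 hg.1 h
  · rintro I ⟨h1, h2⟩
    obtain ⟨f, hf, rfl⟩ := exists_eq_supportIdeal hB h1
    exact ⟨f, ⟨hf, (nilpotenceClass_supportIdeal_le_iff hB hf m).1 h2⟩, rfl⟩

end MatrixChart

end AdNilpotentIdeals

/-! ### Positive systems as orderings of the basis -/

namespace AdNilpotentIdeals

/-- A strict total order on `Fin N` is the pullback of the standard one along a permutation. -/
lemma exists_equiv_lt_iff {N : ℕ} (r : Fin N → Fin N → Prop) (irrefl : ∀ i, ¬ r i i)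
    (trans : ∀ i j k, r i j → r j k → r i k) (total : ∀ i j, i ≠ j → r i j ∨ r j i) :
    ∃ σ : Fin N ≃ Fin N, ∀ i j, r (σ i) (σ j) ↔ i < j := by
  classical
  -- The permutation is the inverse of the rank, the number of predecessors.
  let s : Fin N → Finset (Fin N) := fun i => Finset.univ.filter (fun a => r a i)
  have hs : ∀ i, (s i).card < N := by
    intro i
    have : s i ⊂ Finset.univ := by
      rw [Finset.ssubset_univ_iff]
      intro h
      have : i ∈ s i := h ▸ Finset.mem_univ i
      exact irrefl i (Finset.mem_filter.1 this).2
    simpa using Finset.card_lt_card this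
  let ρ : Fin N → Fin N := fun i => ⟨(s i).card, hs i⟩
  have hρ : ∀ i j, r i j → ρ i < ρ j := by
    intro i j hij
    change (s i).card < (s j).card
    refine Finset.card_lt_card ⟨fun a ha => ?_, fun h => ?_⟩
    · exact Finset.mem_filter.2
        ⟨Finset.mem_univ _, trans _ _ _ (Finset.mem_filter.1 ha).2 hij⟩
    · exact irrefl i (Finset.mem_filter.1 (h (Finset.mem_filter.2 ⟨Finset.mem_univ i, hij⟩))).2
  have hinj : Function.Injective ρ := by
    intro i j h
    by_contra hij
    rcases total i j hij with h' | h'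
    · exact (hρ _ _ h').ne h
    · exact (hρ _ _ h').ne' h
  let e : Fin N ≃ Fin N := Equiv.ofBijective ρ (Finite.injective_iff_bijective.1 hinj)
  have he : ∀ i, ρ (e.symm i) = i := e.apply_symm_apply
  refine ⟨e.symm, fun i j => ⟨fun h => ?_, fun h => ?_⟩⟩
  · have := hρ _ _ h
    rwa [he, he] at this
  · rcases total (e.symm i) (e.symm j) (e.symm.injective.ne h.ne) with h' | h'
    · exact h'
    · have := hρ _ _ h'
      rw [he, he] at this
      exact absurd h this.not_gt

variable {L : Type*} [LieRing L] [LieAlgebra ℂ L] {N : ℕ}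

namespace MatrixChart

/-- Conjugation of a chart by a permutation matrix. -/
def permute (φ : MatrixChart L N) (σ : Fin N ≃ Fin N) : MatrixChart L N where
  toLin := (Matrix.reindexLinearEquiv ℂ ℂ σ.symm σ.symm).toLinearMap ∘ₗ φ.toLin
  injective := (Matrix.reindexLinearEquiv ℂ ℂ σ.symm σ.symm).injective.comp φ.injective
  trace_eq_zero x := by
    rw [← φ.trace_eq_zero x]
    exact Equiv.sum_comp σ fun i => φ.toLin x i i
  exists_eq M hM := by
    obtain ⟨x, hx⟩ := φ.exists_eq (M.submatrix σ.symm σ.symm)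
      ((Equiv.sum_comp σ.symm fun i => M i i).trans hM)
    refine ⟨x, ?_⟩
    ext i j
    simp [hx]
  map_lie x y := by
    simp [φ.map_lie, Matrix.submatrix_mul_equiv, Matrix.submatrix_sub]

lemma permute_apply (φ : MatrixChart L N) (σ : Fin N ≃ Fin N) (x : L) (i j : Fin N) :
    (φ.permute σ).toLin x i j = φ.toLin x (σ i) (σ j) := rfl

/-- The Lie subalgebra `H` consists of the elements with diagonal matrix. -/
def IsDiagonal (φ : MatrixChart L N) (H : LieSubalgebra ℂ L) : Prop :=
  ∀ x, x ∈ H ↔ ∀ i j, i ≠ j → φ.toLin x i j = 0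

variable {φ : MatrixChart L N} {H : LieSubalgebra ℂ L}

lemma IsDiagonal.eq_diagonal (hH : φ.IsDiagonal H) {h : L} (hh : h ∈ H) :
    φ.toLin h = Matrix.diagonal fun i => φ.toLin h i i := by
  ext i j
  by_cases hij : i = j
  · subst hij
    simp
  · rw [Matrix.diagonal_apply_ne _ hij, (hH h).1 hh i j hij]

lemma IsDiagonal.mem_of_eq_diagonal (hH : φ.IsDiagonal H) {h : L} {d : Fin N → ℂ}
    (hh : φ.toLin h = Matrix.diagonal d) : h ∈ H := by
  rw [hH]
  intro i j hij
  rw [hh, Matrix.diagonal_apply_ne _ hij]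

/-- The difference of the `i`-th and the `j`-th diagonal entry, as a function on `H`. -/
def entryDiff (φ : MatrixChart L N) (H : LieSubalgebra ℂ L) (i j : Fin N) : H → ℂ :=
  fun h => φ.toLin (h : L) i i - φ.toLin (h : L) j j

/-- Evaluation at E i i and E j j, up to scalars, gives 1 and -1, which the difference of the
entries a and b attains only for a = i and b = j. -/
lemma IsDiagonal.entryDiff_injective (hH : φ.IsDiagonal H) {i j a b : Fin N} (hij : i ≠ j)
    (h : φ.entryDiff H i j = φ.entryDiff H a b) : i = a ∧ j = b := by
  have : NeZero N := ⟨fun h => by subst h; exact i.elim0⟩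
  obtain ⟨x, c, hx⟩ := φ.exists_diagonal i
  obtain ⟨y, c', hy⟩ := φ.exists_diagonal j
  have h1 := congrFun h ⟨x, hH.mem_of_eq_diagonal hx⟩
  have h2 := congrFun h ⟨y, hH.mem_of_eq_diagonal hy⟩
  simp only [entryDiff, hx, hy, Matrix.diagonal_apply_eq, if_neg hij, if_neg hij.symm, if_true,
    sub_sub_sub_cancel_right] at h1 h2
  constructor
  · by_contra hc
    rw [if_neg (Ne.symm hc)] at h1
    split_ifs at h1 <;> norm_num at h1
  · by_contra hc
    rw [if_neg (Ne.symm hc)] at h2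
    split_ifs at h2 <;> norm_num at h2

lemma entryDiff_self (φ : MatrixChart L N) (H : LieSubalgebra ℂ L) (i : Fin N) :
    φ.entryDiff H i i = 0 := by
  ext h
  simp [entryDiff]

lemma neg_entryDiff (φ : MatrixChart L N) (H : LieSubalgebra ℂ L) (i j : Fin N) :
    -φ.entryDiff H i j = φ.entryDiff H j i := by
  ext h
  simp [entryDiff]

lemma entryDiff_add (φ : MatrixChart L N) (H : LieSubalgebra ℂ L) (i j k : Fin N) :
    φ.entryDiff H i j + φ.entryDiff H j k = φ.entryDiff H i k := by
  ext h
  simp [entryDiff]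

variable [H.IsCartanSubalgebra]

lemma IsDiagonal.unit_mem_rootSpace (hH : φ.IsDiagonal H) {i j : Fin N} (hij : i ≠ j) :
    φ.unit i j ∈ LieAlgebra.rootSpace H (φ.entryDiff H i j) := by
  refine LieModule.weightSpace_le_genWeightSpace _ _ ((LieModule.mem_weightSpace _ _).2 ?_)
  intro h
  apply φ.injective
  ext a b
  change φ.toLin ⁅(h : L), φ.unit i j⁆ a b = _
  rw [φ.map_diagonal_lie_apply (hH.eq_diagonal h.2), map_smul, Matrix.smul_apply,
    φ.toLin_unit hij, Matrix.single_apply, smul_eq_mul]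
  split_ifs with hc
  · rw [← hc.1, ← hc.2, entryDiff]
  · simp

/-- On the entry (i, j), ad h - α h is a scalar; a power of it kills a nonzero entry only if the
scalar is zero. -/
lemma IsDiagonal.eq_entryDiff (hH : φ.IsDiagonal H) {α : H → ℂ} {x : L}
    (hx : x ∈ LieAlgebra.rootSpace H α) {i j : Fin N} (hne : φ.toLin x i j ≠ 0) :
    α = φ.entryDiff H i j := by
  ext h
  obtain ⟨k, hk⟩ := (LieModule.mem_genWeightSpace _ _ _).1 hx h
  have key : ∀ k : ℕ, φ.toLin (((LieModule.toEnd ℂ H L h - α h • (1 : Module.End ℂ L)) ^ k) x) i j =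
      (φ.entryDiff H i j h - α h) ^ k * φ.toLin x i j := by
    intro k
    induction k with
    | zero => simp
    | succ k ih =>
      rw [pow_succ', Module.End.mul_apply]
      set y := ((LieModule.toEnd ℂ H L h - α h • (1 : Module.End ℂ L)) ^ k) x
      change φ.toLin (⁅(h : L), y⁆ - α h • y) i j = _
      rw [map_sub, Matrix.sub_apply, φ.map_diagonal_lie_apply (hH.eq_diagonal h.2), map_smul,
        Matrix.smul_apply, ih, entryDiff, smul_eq_mul]
      ring
  have h0 := key k
  rw [hk, map_zero, Matrix.zero_apply] at h0
  have h1 := (mul_eq_zero.1 h0.symm).resolve_right hne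
  exact (sub_eq_zero.1 (eq_zero_of_pow_eq_zero h1)).symm

lemma IsDiagonal.entryDiff_mem_roots (hH : φ.IsDiagonal H) {i j : Fin N} (hij : i ≠ j) :
    φ.entryDiff H i j ∈ roots H := by
  constructor
  · intro h
    rw [← φ.entryDiff_self H i] at h
    exact hij (hH.entryDiff_injective hij h).2.symm
  · intro h
    have hmem := hH.unit_mem_rootSpace hij
    rw [h, LieSubmodule.mem_bot] at hmem
    have h0 := φ.toLin_unit hij
    rw [hmem, map_zero] at h0
    simpa using congrFun (congrFun h0 i) j

/-- After a permutation of the basis, the Borel subalgebra of a positive system is upper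
triangular. -/
theorem IsDiagonal.exists_isUpper_borel (hH : φ.IsDiagonal H) (P : Set (H → ℂ))
    (hP : IsPositiveSystem H P) : ∃ ψ : MatrixChart L N, ψ.IsUpper (borel H P hP) := by
  have irrefl : ∀ i, φ.entryDiff H i i ∉ P := fun i h =>
    (hP.subset_roots h).1 (φ.entryDiff_self H i)
  -- The axioms of a positive system say that "the root of (i, j) is positive" is a strict total
  -- order on the indices.
  obtain ⟨σ, hσ⟩ := exists_equiv_lt_iff (fun i j => φ.entryDiff H i j ∈ P) irrefl
    (by
      intro i j k hij hjk
      have hik : i ≠ k := by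
        rintro rfl
        have := hP.neg_notMem _ hij
        rw [neg_entryDiff] at this
        exact this hjk
      have := hP.add_mem _ hij _ hjk
      rw [entryDiff_add] at this
      exact this (hH.entryDiff_mem_roots hik))
    (by
      intro i j hij
      have := hP.mem_or_neg_mem _ (hH.entryDiff_mem_roots hij)
      rwa [neg_entryDiff] at this)
  refine ⟨φ.permute σ, fun x => ?_⟩
  have hlow : (∀ a b, b < a → (φ.permute σ).toLin x a b = 0) ↔
      ∀ i j, φ.entryDiff H j i ∈ P → φ.toLin x i j = 0 := by
    constructor
    · intro h i j hij
      have := h (σ.symm i) (σ.symm j) ((hσ _ _).1 (by simpa using hij))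
      simpa [permute_apply] using this
    · intro h a b hab
      exact h _ _ ((hσ _ _).2 hab)
  rw [hlow]
  change x ∈ H.toSubmodule ⊔ nilradicalSubmodule H P ↔ _
  constructor
  · intro hx i j hij
    obtain ⟨h, hh, y, hy, rfl⟩ := Submodule.mem_sup.1 hx
    have hne : i ≠ j := by
      rintro rfl
      exact irrefl _ hij
    let S : Submodule ℂ L :=
      { carrier := {y | φ.toLin y i j = 0}
        zero_mem' := by simp
        add_mem' := by
          intro a b ha hb
          simp only [Set.mem_ofPred_eq] at ha hb ⊢
          simp [ha, hb]
        smul_mem' := by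
          intro c a ha
          simp only [Set.mem_ofPred_eq] at ha ⊢
          simp [ha] }
    have hle : nilradicalSubmodule H P ≤ S := by
      refine iSup₂_le fun α hα y hy => ?_
      by_contra hc
      have := hH.eq_entryDiff hy hc
      have hneg := hP.neg_notMem _ hij
      rw [neg_entryDiff, ← this] at hneg
      exact hneg hα
    have h1 : φ.toLin y i j = 0 := hle hy
    rw [map_add, Matrix.add_apply, (hH h).1 hh i j hne, h1, add_zero]
  · intro hx
    obtain ⟨h, hh⟩ := φ.exists_eq (Matrix.diagonal fun i => φ.toLin x i i) (by
      rw [Matrix.trace_diagonal]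
      exact φ.trace_eq_zero x)
    refine Submodule.mem_sup.2 ⟨h, hH.mem_of_eq_diagonal hh, x - h, ?_, by abel⟩
    refine φ.mem_of_unit_mem (fun i => ?_) (fun i j hij hne => ?_)
    · rw [map_sub, hh]
      simp
    · rw [map_sub, hh, Matrix.sub_apply, Matrix.diagonal_apply_ne _ hij, sub_zero] at hne
      have hα : φ.entryDiff H i j ∈ P := by
        have := hP.mem_or_neg_mem _ (hH.entryDiff_mem_roots hij)
        rw [neg_entryDiff] at this
        exact this.resolve_right fun h => hne (hx i j h)
      exact (le_iSup₂ (f := fun (α : H → ℂ) (_ : α ∈ P) =>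
        (LieAlgebra.rootSpace H α).toSubmodule) _ hα) (hH.unit_mem_rootSpace hij)

end MatrixChart

end AdNilpotentIdeals

/-! ### Diagonalizing a Cartan subalgebra of sl -/

namespace AdNilpotentIdeals

section

open LieAlgebra.SpecialLinear Matrix

attribute [local instance] LieRing.ofAssociativeRing

lemma mem_sl_iff {N : ℕ} (A : Matrix (Fin N) (Fin N) ℂ) : A ∈ sl (Fin N) ℂ ↔ A.trace = 0 :=
  LinearMap.mem_ker

lemma isNilpotent_mulLeft_sub_mulRight {N : ℕ} {M : Matrix (Fin N) (Fin N) ℂ} (hM : IsNilpotent M) :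
    IsNilpotent (LinearMap.mulLeft ℂ M - LinearMap.mulRight ℂ M) :=
  (LinearMap.commute_mulLeft_right (R := ℂ) M M).isNilpotent_sub
    ((LinearMap.isNilpotent_mulLeft_iff ℂ M).2 hM) ((LinearMap.isNilpotent_mulRight_iff ℂ M).2 hM)

/-- The chart of `sl` given by the matrices with respect to a basis. -/
noncomputable def basisChart {N : ℕ} (b : Module.Basis (Fin N) ℂ (Fin N → ℂ)) :
    MatrixChart (sl (Fin N) ℂ) N where
  toLin := (LinearMap.toMatrix b b).toLinearMap ∘ₗ Matrix.toLin'.toLinearMap ∘ₗ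
    (sl (Fin N) ℂ).toSubmodule.subtype
  injective := (LinearMap.toMatrix b b).injective.comp
    (Matrix.toLin'.injective.comp Subtype.val_injective)
  trace_eq_zero x := by
    change (LinearMap.toMatrix b b (Matrix.toLin' x.val)).trace = 0
    rw [← LinearMap.trace_eq_matrix_trace, Matrix.trace_toLin'_eq]
    exact (mem_sl_iff _).1 x.2
  exists_eq M hM := by
    refine ⟨⟨LinearMap.toMatrix' (Matrix.toLin b b M), ?_⟩, ?_⟩
    · rw [mem_sl_iff, ← Matrix.trace_toLin'_eq, Matrix.toLin'_toMatrix', LinearMap.trace_eq_matrix_trace ℂ b,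
        LinearMap.toMatrix_toLin]
      exact hM
    · change LinearMap.toMatrix b b (Matrix.toLin' (LinearMap.toMatrix' (Matrix.toLin b b M))) = M
      rw [Matrix.toLin'_toMatrix', LinearMap.toMatrix_toLin]
  map_lie x y := by
    change LinearMap.toMatrix b b (Matrix.toLin' (x.val * y.val - y.val * x.val)) =
      LinearMap.toMatrix b b (Matrix.toLin' x.val) * LinearMap.toMatrix b b (Matrix.toLin' y.val) -
      LinearMap.toMatrix b b (Matrix.toLin' y.val) * LinearMap.toMatrix b b (Matrix.toLin' x.val)
    rw [map_sub, Matrix.toLin'_mul, Matrix.toLin'_mul, map_sub, LinearMap.toMatrix_comp b b b,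
      LinearMap.toMatrix_comp b b b]

variable {N : ℕ} (H : LieSubalgebra ℂ (sl (Fin N) ℂ)) [H.IsCartanSubalgebra]

/-- The standard representation has a basis adapted to its decomposition into generalized weight
spaces for a Cartan subalgebra. -/
lemma exists_weight_basis : ∃ (b : Module.Basis (Fin N) ℂ (Fin N → ℂ)) (χ : Fin N → H → ℂ),
    (∀ i, b i ∈ LieModule.genWeightSpace (Fin N → ℂ) (χ i)) ∧
    ∀ i j, ∀ v ∈ LieModule.genWeightSpace (Fin N → ℂ) (χ i), χ i ≠ χ j → b.repr v j = 0 := by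
  classical
  let A : LieModule.Weight ℂ H (Fin N → ℂ) → Submodule ℂ (Fin N → ℂ) :=
    fun χ => (LieModule.genWeightSpace (Fin N → ℂ) χ).toSubmodule
  have hA : DirectSum.IsInternal A := by
    rw [DirectSum.isInternal_submodule_iff_iSupIndep_and_iSup_eq_top]
    exact ⟨LieSubmodule.iSupIndep_toSubmodule.2 (LieModule.iSupIndep_genWeightSpace' ℂ H _),
      LieSubmodule.iSup_toSubmodule_eq_top.2 (LieModule.iSup_genWeightSpace_eq_top' ℂ H _)⟩
  let c := hA.collectedBasis fun χ => Module.finBasis ℂ (A χ)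
  have hcard : Fintype.card (Σ χ, Fin (Module.finrank ℂ (A χ))) = Fintype.card (Fin N) := by
    rw [← Module.finrank_eq_card_basis c, Module.finrank_fin_fun, Fintype.card_fin]
  let e := Fintype.equivOfCardEq hcard
  refine ⟨c.reindex e, fun i => (e.symm i).1, fun i => ?_, fun i j v hv hij => ?_⟩
  · rw [Module.Basis.reindex_apply]
    exact hA.collectedBasis_mem _ _
  · rw [Module.Basis.repr_reindex_apply]
    have hne : (e.symm i).1 ≠ (e.symm j).1 := 
      fun h => hij (congrArg (fun ψ : LieModule.Weight ℂ H (Fin N → ℂ) => (ψ : H → ℂ)) h)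
    exact hA.collectedBasis_repr_of_mem_ne _ hne hv

variable {H} {b : Module.Basis (Fin N) ℂ (Fin N → ℂ)} {χ : Fin N → H → ℂ}

lemma basisChart_apply (x : sl (Fin N) ℂ) (i j : Fin N) :
    (basisChart b).toLin x i j = b.repr (x.val *ᵥ b j) i := by
  change LinearMap.toMatrix b b (Matrix.toLin' x.val) i j = _
  rw [LinearMap.toMatrix_apply, Matrix.toLin'_apply]

lemma basisChart_mulVec_repr (x : sl (Fin N) ℂ) (v : Fin N → ℂ) :
    (basisChart b).toLin x *ᵥ b.repr v = b.repr (x.val *ᵥ v) := by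
  change LinearMap.toMatrix b b (Matrix.toLin' x.val) *ᵥ b.repr v = _
  rw [LinearMap.toMatrix_mulVec_repr, Matrix.toLin'_apply]

lemma basisChart_apply_eq_zero
    (hb : ∀ i, b i ∈ LieModule.genWeightSpace (Fin N → ℂ) (χ i))
    (hbne : ∀ i j, ∀ v ∈ LieModule.genWeightSpace (Fin N → ℂ) (χ i), χ i ≠ χ j → b.repr v j = 0)
    (h : H) {i j : Fin N} (hij : χ i ≠ χ j) : (basisChart b).toLin (h : sl (Fin N) ℂ) i j = 0 := by
  rw [basisChart_apply]
  exact hbne j i _ (LieSubmodule.lie_mem (x := h) _ (hb j)) hij.symm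

/-- The matrix of an element of the Cartan subalgebra is the sum of the diagonal matrix of its
weights and a nilpotent matrix. -/
lemma isNilpotent_basisChart_sub
    (hb : ∀ i, b i ∈ LieModule.genWeightSpace (Fin N → ℂ) (χ i))
    (hbne : ∀ i j, ∀ v ∈ LieModule.genWeightSpace (Fin N → ℂ) (χ i), χ i ≠ χ j → b.repr v j = 0)
    (h : H) : IsNilpotent
      ((basisChart b).toLin (h : sl (Fin N) ℂ) - Matrix.diagonal fun i => χ i h) := by
  set M := (basisChart b).toLin (h : sl (Fin N) ℂ) - Matrix.diagonal fun i => χ i h with hM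
  have hstep : ∀ j, ∀ v ∈ LieModule.genWeightSpace (Fin N → ℂ) (χ j),
      M *ᵥ b.repr v = b.repr (⁅h, v⁆ - χ j h • v) := by
    intro j v hv
    rw [hM, Matrix.sub_mulVec, basisChart_mulVec_repr]
    ext i
    rw [Pi.sub_apply, Matrix.mulVec_diagonal, map_sub, map_smul, Finsupp.sub_apply,
      Finsupp.smul_apply, smul_eq_mul]
    congr 1
    by_cases hij : χ j = χ i
    · rw [hij]
    · rw [hbne j i v hv hij, mul_zero, mul_zero]
  have hpow : ∀ j (k : ℕ), ∀ v ∈ LieModule.genWeightSpace (Fin N → ℂ) (χ j),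
      (M ^ k) *ᵥ b.repr v =
        b.repr (((LieModule.toEnd ℂ H (Fin N → ℂ) h - χ j h • (1 : Module.End ℂ (Fin N → ℂ))) ^ k)
          v) := by
    intro j k
    induction k with
    | zero => intro v _; simp
    | succ k ih =>
      intro v hv
      rw [pow_succ, ← Matrix.mulVec_mulVec, hstep j v hv, pow_succ, Module.End.mul_apply]
      exact ih _ (sub_mem (LieSubmodule.lie_mem _ hv) (SMulMemClass.smul_mem _ hv))
  have hk : ∀ j, ∃ k : ℕ, (M ^ k) *ᵥ Pi.single j 1 = 0 := by
    intro j
    obtain ⟨k, hk⟩ := (LieModule.mem_genWeightSpace _ _ _).1 (hb j) h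
    refine ⟨k, ?_⟩
    have := hpow j k _ (hb j)
    rw [hk, map_zero, Module.Basis.repr_self, Finsupp.single_eq_pi_single] at this
    simpa using this
  choose k hk using hk
  refine ⟨∑ j, k j, ?_⟩
  ext i j
  have hle : k j ≤ ∑ j, k j := Finset.single_le_sum (fun _ _ => Nat.zero_le _) (Finset.mem_univ j)
  have : (M ^ ∑ j, k j) *ᵥ Pi.single j 1 = 0 := by
    rw [← Nat.sub_add_cancel hle, pow_add, ← Matrix.mulVec_mulVec, hk, Matrix.mulVec_zero]
  simpa using congrFun this i

/-- Block diagonal matrices belong to the Cartan subalgebra. -/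
lemma mem_of_basisChart_apply_eq_zero
    (hb : ∀ i, b i ∈ LieModule.genWeightSpace (Fin N → ℂ) (χ i))
    (hbne : ∀ i j, ∀ v ∈ LieModule.genWeightSpace (Fin N → ℂ) (χ i), χ i ≠ χ j → b.repr v j = 0)
    {x : sl (Fin N) ℂ} (hx : ∀ i j, χ i ≠ χ j → (basisChart b).toLin x i j = 0) : x ∈ H := by
  have hmem : x ∈ LieAlgebra.rootSpace H (0 : H → ℂ) := by
    rw [LieModule.mem_genWeightSpace]
    intro h
    have hnil := isNilpotent_mulLeft_sub_mulRight (isNilpotent_basisChart_sub hb hbne h)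
    set M := (basisChart b).toLin (h : sl (Fin N) ℂ) - Matrix.diagonal fun i => χ i h with hM
    have hblock : ∀ i j, χ i ≠ χ j → M i j = 0 := by
      intro i j hij
      have : i ≠ j := fun h => hij (by rw [h])
      rw [hM, Matrix.sub_apply, basisChart_apply_eq_zero hb hbne h hij,
        Matrix.diagonal_apply_ne _ this, sub_zero]
    -- The diagonal part of h is scalar on each block and commutes with block diagonal matrices, so
    -- there ad h acts as the commutator with the nilpotent M.
    have key : ∀ k : ℕ,
        (basisChart b).toLin (((LieModule.toEnd ℂ H (sl (Fin N) ℂ) h) ^ k) x) =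
          ((LinearMap.mulLeft ℂ M - LinearMap.mulRight ℂ M) ^ k) ((basisChart b).toLin x) ∧
        ∀ i j, χ i ≠ χ j →
          (basisChart b).toLin (((LieModule.toEnd ℂ H (sl (Fin N) ℂ) h) ^ k) x) i j = 0 := by
      intro k
      induction k with
      | zero => exact ⟨rfl, hx⟩
      | succ k ih =>
        rw [pow_succ', pow_succ', Module.End.mul_apply, Module.End.mul_apply, ← ih.1]
        set y := ((LieModule.toEnd ℂ H (sl (Fin N) ℂ) h) ^ k) x
        have h1 : (basisChart b).toLin (LieModule.toEnd ℂ H (sl (Fin N) ℂ) h y) =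
            (LinearMap.mulLeft ℂ M - LinearMap.mulRight ℂ M) ((basisChart b).toLin y) := by
          change (basisChart b).toLin ⁅(h : sl (Fin N) ℂ), y⁆ = _
          have h2 : (basisChart b).toLin (h : sl (Fin N) ℂ) =
              M + Matrix.diagonal fun i => χ i h := by rw [hM, sub_add_cancel]
          rw [(basisChart b).map_lie, h2, LinearMap.sub_apply, LinearMap.mulLeft_apply,
            LinearMap.mulRight_apply, add_mul, mul_add]
          have h3 : (Matrix.diagonal fun i => χ i h) * (basisChart b).toLin y =
              (basisChart b).toLin y * Matrix.diagonal fun i => χ i h := by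
            ext i j
            rw [Matrix.diagonal_mul, Matrix.mul_diagonal]
            by_cases hij : χ i = χ j
            · rw [hij, mul_comm]
            · rw [ih.2 i j hij, mul_zero, zero_mul]
          rw [h3]
          abel
        refine ⟨h1, fun i j hij => ?_⟩
        rw [h1, LinearMap.sub_apply, LinearMap.mulLeft_apply, LinearMap.mulRight_apply,
          Matrix.sub_apply, Matrix.mul_apply, Matrix.mul_apply, Finset.sum_eq_zero,
          Finset.sum_eq_zero, sub_zero]
        · intro m _
          by_cases him : χ i = χ m
          · rw [hblock m j (him ▸ hij), mul_zero]
          · rw [ih.2 i m him, zero_mul]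
        · intro m _
          by_cases him : χ i = χ m
          · rw [ih.2 m j (him ▸ hij), mul_zero]
          · rw [hblock i m him, zero_mul]
    obtain ⟨k, hk⟩ := hnil
    refine ⟨k, (basisChart b).injective ?_⟩
    rw [Pi.zero_apply, zero_smul, sub_zero, (key k).1, hk, LinearMap.zero_apply, map_zero]
  -- A Cartan subalgebra is its own zero root space.
  rw [LieAlgebra.rootSpace_zero_eq] at hmem
  exact hmem

/-- If i and j share a weight, then E i i - E j j and E i j are block diagonal and hence in H. Their
bracket is 2 E i j, so the first is not ad-nilpotent on H, although H is nilpotent. -/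
lemma weight_injective
    (hb : ∀ i, b i ∈ LieModule.genWeightSpace (Fin N → ℂ) (χ i))
    (hbne : ∀ i j, ∀ v ∈ LieModule.genWeightSpace (Fin N → ℂ) (χ i), χ i ≠ χ j → b.repr v j = 0) :
    Function.Injective χ := by
  intro i j hχ
  by_contra hij
  set φ := basisChart b
  obtain ⟨d, hd⟩ := φ.exists_eq
    (Matrix.diagonal fun a => (if a = i then 1 else 0) - if a = j then 1 else 0) (by
      rw [Matrix.trace_diagonal, Finset.sum_sub_distrib]
      simp)
  have hdH : d ∈ H := by
    refine mem_of_basisChart_apply_eq_zero hb hbne fun a c hac => ?_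
    have : a ≠ c := fun h => hac (by rw [h])
    rw [hd, Matrix.diagonal_apply_ne _ this]
  have huH : φ.unit i j ∈ H := by
    refine mem_of_basisChart_apply_eq_zero hb hbne fun a c hac => ?_
    rw [φ.toLin_unit hij, Matrix.single_apply, if_neg]
    rintro ⟨rfl, rfl⟩
    exact hac hχ
  have hlie : ⁅(⟨d, hdH⟩ : H), (⟨φ.unit i j, huH⟩ : H)⁆ = (2 : ℂ) • (⟨φ.unit i j, huH⟩ : H) := by
    refine Subtype.ext (φ.injective ?_)
    change φ.toLin ⁅d, φ.unit i j⁆ = φ.toLin ((2 : ℂ) • φ.unit i j)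
    ext a c
    rw [φ.map_diagonal_lie_apply hd, map_smul, Matrix.smul_apply, smul_eq_mul, φ.toLin_unit hij,
      Matrix.single_apply]
    split_ifs with h1 h2 h3 h4 h5 <;> grind
  obtain ⟨k, hk⟩ := LieModule.isNilpotent_toEnd_of_isNilpotent ℂ H H (⟨d, hdH⟩ : H)
  have hpow : ∀ k : ℕ, ((LieModule.toEnd ℂ H H ⟨d, hdH⟩) ^ k) ⟨φ.unit i j, huH⟩ =
      (2 : ℂ) ^ k • (⟨φ.unit i j, huH⟩ : H) := by
    intro k
    induction k with
    | zero => simp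
    | succ k ih =>
      rw [pow_succ', Module.End.mul_apply, ih, map_smul, LieModule.toEnd_apply_apply, hlie,
        smul_smul, pow_succ]
  have h0 := hpow k
  rw [hk, LinearMap.zero_apply] at h0
  have h1 := (smul_eq_zero.1 h0.symm).resolve_left (pow_ne_zero _ two_ne_zero)
  have h2 : φ.unit i j = 0 := congrArg Subtype.val h1
  have h3 := φ.toLin_unit hij
  rw [h2, map_zero] at h3
  simpa using congrFun (congrFun h3 i) j

/-- Every Cartan subalgebra of `sl` is diagonal in a suitable basis. -/
theorem exists_isDiagonal (H : LieSubalgebra ℂ (sl (Fin N) ℂ)) [H.IsCartanSubalgebra] :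
    ∃ φ : MatrixChart (sl (Fin N) ℂ) N, φ.IsDiagonal H := by
  obtain ⟨b, χ, hb, hbne⟩ := exists_weight_basis H
  have hχ := weight_injective hb hbne
  refine ⟨basisChart b, fun x => ⟨fun hx i j hij => ?_, fun hx => ?_⟩⟩
  · exact basisChart_apply_eq_zero hb hbne ⟨x, hx⟩ (hχ.ne hij)
  · exact mem_of_basisChart_apply_eq_zero hb hbne fun i j hij =>
      hx i j fun h => hij (by rw [h])

end

end AdNilpotentIdeals

theorem corollary4p7 (n : ℕ)
    (H : LieSubalgebra ℂ (LieAlgebra.SpecialLinear.sl (Fin (n + 1)) ℂ))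
    [H.IsCartanSubalgebra] (P : Set (H → ℂ))
    (hP : AdNilpotentIdeals.IsPositiveSystem H P) :
    {I : LieIdeal ℂ (AdNilpotentIdeals.borel H P hP) |
        AdNilpotentIdeals.IsAdNilpotent I ∧ AdNilpotentIdeals.nilpotenceClass I ≤ 2}.ncard
      = Nat.fib (2 * n + 1) ∧
    (({I : LieIdeal ℂ (AdNilpotentIdeals.borel H P hP) |
        AdNilpotentIdeals.IsAdNilpotent I ∧ AdNilpotentIdeals.nilpotenceClass I ≤ 3}.ncard : ℚ)
      = (3 ^ n + 1) / 2) := by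
  obtain ⟨φ, hφ⟩ := AdNilpotentIdeals.exists_isDiagonal H
  obtain ⟨ψ, hψ⟩ := hφ.exists_isUpper_borel P hP
  rw [AdNilpotentIdeals.MatrixChart.ncard_isAdNilpotent_nilpotenceClass_le hψ,
    AdNilpotentIdeals.MatrixChart.ncard_isAdNilpotent_nilpotenceClass_le hψ,
    -- Class at most 3 means four iterations of f, hence the convergent D 5; class at most 2
    -- likewise leads to D 4.
    AdNilpotentIdeals.ncard_bounceFunctions 4 (n + 1),
    AdNilpotentIdeals.coeff_dyckSeries_five]
  refine ⟨?_, rfl⟩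
  have := AdNilpotentIdeals.ncard_bounceFunctions 3 (n + 1)
  rw [AdNilpotentIdeals.coeff_dyckSeries_four] at this
  exact_mod_cast this
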